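/- Let $H_0,H_1$ be complex Hilbert spaces and let $A$ on $H_0$ and $\Omega_1$ on $H_1$ be (possibly unbounded) self-adjoint operators with domains $\mathcal D(A)$ and $\mathcal D(\Omega_1)$. Let $\Gamma:\mathcal D(\Omega_1)\to H_0$ be a linear map which is $\Omega_1$-bounded: there is $C<\infty$ with $\|\Gamma\phi\|^2\le C\|(\Omega_1+\mathrm i)\phi\|^2$ for all $\phi\in\mathcal D(\Omega_1)$. For $R>0$ put $\Phi_R=R\,(\Omega_1^2+R^2)^{-1/2}$; this bounded operator maps $H_1$ into $\mathcal D(\Omega_1)$, and $\Gamma\Phi_R$ and $S:=\Gamma(\Omega_1+\mathrm i)^{-1}$ are bounded operators from $H_1$ to $H_0$. Suppose that the limit $$Gv:=\lim_{R\to\infty}\Gamma\Phi_R S^\dagger v$$ exists for every $v\in\mathcal D(A)$, and that there are $\delta<1$ and $\beta>0$ with $\|Gv\|\le\delta\,\|(A+\mathrm i\beta)v\|$ for all $v\in\mathcal D(A)$. Define the operator $\mathcal A$ on $H_0\oplus H_1$ (formally $\begin{bmatrix}A&\Gamma\\ \Gamma^\dagger&\Omega_1\end{bmatrix}$) by $$\mathcal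 A\begin{bmatrix}v\\ w\end{bmatrix}:=\lim_{R\to\infty}\begin{bmatrix}Av+\Gamma\Phi_R w\\ (\Gamma\Phi_R)^\dagger v+\Omega_1\Phi_R w\end{bmatrix}$$ on the domain $\mathcal D(\mathcal A)$ of all $(v,w)$ with $v\in\mathcal D(A)$ for which this limit exists. Then $$\mathcal D(\mathcal A)=\Big\{\begin{bmatrix}v\\ w\end{bmatrix}: v\in\mathcal D(A),\ \lim_{R\to\infty}\big((\Gamma\Phi_R)^\dagger v+\Omega_1\Phi_R w\big)\text{ exists}\Big\}=\Big\{\begin{bmatrix}v\\ \phi-S^\dagger v\end{bmatrix}: v\in\mathcal D(A),\ \phi\in\mathcal D(\Omega_1)\Big\},$$ and $\mathcal A$ is self-adjoint. -/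

import Mathlib

open Filter Topology

set_option linter.unusedSectionVars false

noncomputable section

namespace BlockOperator

variable {H H₀ H₁ : Type*}
  [NormedAddCommGroup H] [InnerProductSpace ℂ H] [CompleteSpace H]
  [NormedAddCommGroup H₀] [InnerProductSpace ℂ H₀] [CompleteSpace H₀]
  [NormedAddCommGroup H₁] [InnerProductSpace ℂ H₁] [CompleteSpace H₁]

/-- The operator `T + c I`, with domain `D(T)`. -/
def addScalar (T : H →ₗ.[ℂ] H) (c : ℂ) : H →ₗ.[ℂ] H where
  domain := T.domain
  toFun := T.toFun + c • T.domain.subtype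

/-- The operator `T ^ 2`, with domain `{x ∈ D(T) | T x ∈ D(T)}`. -/
def square (T : H →ₗ.[ℂ] H) : H →ₗ.[ℂ] H where
  domain :=
    { carrier := {x | ∃ h : x ∈ T.domain, T ⟨x, h⟩ ∈ T.domain}
      zero_mem' := ⟨T.domain.zero_mem, by
        have : T ⟨0, T.domain.zero_mem⟩ = 0 := T.map_zero
        rw [this]; exact T.domain.zero_mem⟩
      add_mem' := by
        rintro x y ⟨hx, hx'⟩ ⟨hy, hy'⟩
        refine ⟨T.domain.add_mem hx hy, ?_⟩
        have : T ⟨x + y, T.domain.add_mem hx hy⟩ = T ⟨x, hx⟩ + T ⟨y, hy⟩ :=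
          T.map_add ⟨x, hx⟩ ⟨y, hy⟩
        rw [this]; exact T.domain.add_mem hx' hy'
      smul_mem' := by
        rintro c x ⟨hx, hx'⟩
        refine ⟨T.domain.smul_mem c hx, ?_⟩
        have : T ⟨c • x, T.domain.smul_mem c hx⟩ = c • T ⟨x, hx⟩ := T.map_smul c ⟨x, hx⟩
        rw [this]; exact T.domain.smul_mem c hx' }
  toFun :=
    { toFun := fun x => T ⟨T ⟨x.1, x.2.1⟩, x.2.2⟩
      map_add' := by
        intro x y
        rw [← T.map_add]
        congr 1
        exact Subtype.ext (T.map_add ⟨x.1, x.2.1⟩ ⟨y.1, y.2.1⟩)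
      map_smul' := by
        intro c x
        rw [RingHom.id_apply, ← T.map_smul]
        congr 1
        exact Subtype.ext (T.map_smul c ⟨x.1, x.2.1⟩) }

/-- `B` is a bounded everywhere defined two-sided inverse of the operator `T`. -/
def IsBoundedInverse (T : H →ₗ.[ℂ] H) (B : H →L[ℂ] H) : Prop :=
  (∀ y : H, ∃ h : B y ∈ T.domain, T ⟨B y, h⟩ = y) ∧ ∀ x : T.domain, B (T x) = x

open Classical in
/-- The bounded inverse `T⁻¹` of an operator `T`, if there is one (and `0` otherwise). -/
def boundedInverse (T : H →ₗ.[ℂ] H) : H →L[ℂ] H :=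
  if h : ∃ B : H →L[ℂ] H, IsBoundedInverse T B then h.choose else 0

/-- The bounded function `R / √(Ω ^ 2 + R ^ 2)` of the operator `Ω`: the positive square root of
the bounded positive operator `R ^ 2 (Ω ^ 2 + R ^ 2)⁻¹`. -/
def cutoff (Ω : H →ₗ.[ℂ] H) (R : ℝ) : H →L[ℂ] H :=
  CFC.sqrt (((R ^ 2 : ℝ) : ℂ) • boundedInverse (addScalar (square Ω) ((R ^ 2 : ℝ) : ℂ)))

open Classical in
/-- The composition `Γ B`, as a bounded operator on `H₁`, of a linear map `Γ : D → H₀` defined on a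
subspace `D` of `H₁` with a bounded operator `B` on `H₁` (and `0` if `B` does not map into `D` or
the composition is not bounded). -/
def compBounded {D : Submodule ℂ H₁} (Γ : D →ₗ[ℂ] H₀) (B : H₁ →L[ℂ] H₁) : H₁ →L[ℂ] H₀ :=
  if h : ∃ C : H₁ →L[ℂ] H₀, ∀ x, ∃ hx : B x ∈ D, C x = Γ ⟨B x, hx⟩ then h.choose else 0

/-- The bounded operator `S = Γ (Ω + i)⁻¹`. -/
def opS (Ω : H₁ →ₗ.[ℂ] H₁) (Γ : Ω.domain →ₗ[ℂ] H₀) : H₁ →L[ℂ] H₀ :=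
  compBounded Γ (boundedInverse (addScalar Ω Complex.I))

/-- The vector `(A v + Γ Φ_R w, (Γ Φ_R)† v + Ω Φ_R w)`. -/
def blockApprox (A : H₀ →ₗ.[ℂ] H₀) (Ω : H₁ →ₗ.[ℂ] H₁) (Γ : Ω.domain →ₗ[ℂ] H₀)
    (v : A.domain) (w : H₁) (R : ℝ) : WithLp 2 (H₀ × H₁) :=
  WithLp.toLp 2
    (A v + compBounded Γ (cutoff Ω R) w,
      (compBounded Γ (cutoff Ω R)).adjoint (v : H₀) + compBounded Ω.toFun (cutoff Ω R) w)

section linear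
variable (A : H₀ →ₗ.[ℂ] H₀) (Ω : H₁ →ₗ.[ℂ] H₁) (Γ : Ω.domain →ₗ[ℂ] H₀)

theorem blockApprox_add (v v' : A.domain) (w w' : H₁) (R : ℝ) :
    blockApprox A Ω Γ (v + v') (w + w') R
      = blockApprox A Ω Γ v w R + blockApprox A Ω Γ v' w' R := by
  simp only [blockApprox, ← WithLp.toLp_add, Prod.mk_add_mk, A.map_add, map_add,
    Submodule.coe_add]
  congr 2 <;> abel

theorem blockApprox_smul (c : ℂ) (v : A.domain) (w : H₁) (R : ℝ) :
    blockApprox A Ω Γ (c • v) (c • w) R = c • blockApprox A Ω Γ v w R := by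
  simp only [blockApprox, ← WithLp.toLp_smul, Prod.smul_mk, A.map_smul, map_smul,
    Submodule.coe_smul, smul_add]

end linear

/-- The block operator `[[A, Γ], [Γ†, Ω]]` on `H₀ ⊕ H₁`: it maps `(v, w)` to the limit of
`(A v + Γ Φ_R w, (Γ Φ_R)† v + Ω Φ_R w)` as `R → ∞`, and its domain consists of all `(v, w)` with
`v ∈ D(A)` for which the limit exists. -/
def blockOperator (A : H₀ →ₗ.[ℂ] H₀) (Ω : H₁ →ₗ.[ℂ] H₁) (Γ : Ω.domain →ₗ[ℂ] H₀) :
    WithLp 2 (H₀ × H₁) →ₗ.[ℂ] WithLp 2 (H₀ × H₁) where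
  domain :=
    { carrier := {V | ∃ h : V.fst ∈ A.domain, ∃ L : WithLp 2 (H₀ × H₁),
        Tendsto (blockApprox A Ω Γ ⟨V.fst, h⟩ V.snd) atTop (𝓝 L)}
      zero_mem' := by
        refine ⟨A.domain.zero_mem, 0, ?_⟩
        have : blockApprox A Ω Γ 0 0 = fun _ => 0 := by
          funext R
          simpa using blockApprox_smul A Ω Γ 0 0 0 R
        exact this ▸ tendsto_const_nhds
      add_mem' := by
        rintro V V' ⟨h, L, hL⟩ ⟨h', L', hL'⟩
        refine ⟨A.domain.add_mem h h', L + L', (hL.add hL').congr fun R => ?_⟩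
        exact (blockApprox_add A Ω Γ ⟨V.fst, h⟩ ⟨V'.fst, h'⟩ V.snd V'.snd R).symm
      smul_mem' := by
        rintro c V ⟨h, L, hL⟩
        refine ⟨A.domain.smul_mem c h, c • L, (hL.const_smul c).congr fun R => ?_⟩
        exact (blockApprox_smul A Ω Γ c ⟨V.fst, h⟩ V.snd R).symm }
  toFun :=
    { toFun := fun V => limUnder atTop (blockApprox A Ω Γ ⟨V.1.fst, V.2.1⟩ V.1.snd)
      map_add' := by
        rintro ⟨V, h, L, hL⟩ ⟨V', h', L', hL'⟩
        have e : Tendsto (blockApprox A Ω Γ ⟨(V + V').fst, A.domain.add_mem h h'⟩ (V + V').snd)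
            atTop (𝓝 (L + L')) :=
          (hL.add hL').congr fun R =>
            (blockApprox_add A Ω Γ ⟨V.fst, h⟩ ⟨V'.fst, h'⟩ V.snd V'.snd R).symm
        exact e.limUnder_eq.trans (by rw [hL.limUnder_eq, hL'.limUnder_eq])
      map_smul' := by
        rintro c ⟨V, h, L, hL⟩
        have e : Tendsto (blockApprox A Ω Γ ⟨(c • V).fst, A.domain.smul_mem c h⟩ (c • V).snd)
            atTop (𝓝 (c • L)) :=
          (hL.const_smul c).congr fun R =>
            (blockApprox_smul A Ω Γ c ⟨V.fst, h⟩ V.snd R).symm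
        exact e.limUnder_eq.trans (by rw [hL.limUnder_eq, RingHom.id_apply]) }

/-- On its domain the block operator is given by the limit. -/
theorem tendsto_blockOperator (A : H₀ →ₗ.[ℂ] H₀) (Ω : H₁ →ₗ.[ℂ] H₁) (Γ : Ω.domain →ₗ[ℂ] H₀)
    (V : (blockOperator A Ω Γ).domain) :
    Tendsto (blockApprox A Ω Γ ⟨V.1.fst, V.2.1⟩ V.1.snd) atTop (𝓝 (blockOperator A Ω Γ V)) :=
  tendsto_nhds_limUnder V.2.2

/-! The objects above are not default values when `Ω` is self-adjoint. -/

theorem boundedInverse_spec {T : H →ₗ.[ℂ] H} (h : ∃ B, IsBoundedInverse T B) :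
    IsBoundedInverse T (boundedInverse T) := by
  rw [boundedInverse, dif_pos h]; exact h.choose_spec

theorem inner_symm_of_isSelfAdjoint {T : H →ₗ.[ℂ] H} (hT : IsSelfAdjoint T) (x y : T.domain) :
    inner ℂ (T x) (y : H) = inner ℂ (x : H) (T y) := by
  have h := LinearPMap.adjoint_isFormalAdjoint hT.dense_domain
  rw [LinearPMap.isSelfAdjoint_def.mp hT] at h
  exact h x y

theorem norm_sq_add_I {T : H →ₗ.[ℂ] H} (hT : IsSelfAdjoint T) (r : ℝ) (x : T.domain) :
    ‖T x + (Complex.I * r) • (x : H)‖ ^ 2 = ‖T x‖ ^ 2 + r ^ 2 * ‖(x : H)‖ ^ 2 := by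
  have him : (inner ℂ (T x) (x : H)).im = 0 := by
    have h := inner_symm_of_isSelfAdjoint hT x x
    rw [← inner_conj_symm (x : H) (T x)] at h
    exact Complex.conj_eq_iff_im.mp h.symm
  rw [norm_add_sq (𝕜 := ℂ), inner_smul_right, norm_smul]
  have : RCLike.re (Complex.I * r * inner ℂ (T x) (x : H)) = 0 := by
    simp [him]
  rw [this]
  simp [mul_pow]

theorem norm_le_add_I {T : H →ₗ.[ℂ] H} (hT : IsSelfAdjoint T) (r : ℝ) (x : T.domain) :
    |r| * ‖(x : H)‖ ≤ ‖T x + (Complex.I * r) • (x : H)‖ := by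
  apply le_of_sq_le_sq _ (norm_nonneg _)
  rw [norm_sq_add_I hT, mul_pow, sq_abs]
  nlinarith [sq_nonneg ‖T x‖]

theorem eq_zero_of_inner_range {T : H →ₗ.[ℂ] H} (hT : IsSelfAdjoint T) {r : ℝ} (hr : r ≠ 0)
    {y : H} (hy : ∀ x : T.domain, inner ℂ (T x + (Complex.I * r) • (x : H)) y = 0) : y = 0 := by
  have hy' : ∀ x : T.domain, inner ℂ ((Complex.I * r) • y) (x : H) = inner ℂ y (T x) := by
    intro x
    have h := hy x
    rw [inner_eq_zero_symm, inner_add_right, inner_smul_right] at h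
    rw [inner_smul_left]
    simp only [map_mul, Complex.conj_I, Complex.conj_ofReal]
    linear_combination -h
  have hmem : y ∈ T.adjoint.domain := LinearPMap.mem_adjoint_domain_of_exists y ⟨_, hy'⟩
  have happ : T.adjoint ⟨y, hmem⟩ = (Complex.I * r) • y :=
    LinearPMap.adjoint_apply_eq hT.dense_domain ⟨y, hmem⟩ hy'
  have hadj : T.adjoint = T := LinearPMap.isSelfAdjoint_def.mp hT
  have hmem' : y ∈ T.domain := hadj ▸ hmem
  have happ' : T ⟨y, hmem'⟩ = (Complex.I * r) • y := by
    rw [← happ]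
    have hext := (LinearPMap.ext_iff.mp hadj).2
    exact (@hext y hmem hmem').symm
  have h2 := norm_sq_add_I hT (-r) ⟨y, hmem'⟩
  rw [happ'] at h2
  have h0 : (Complex.I * r) • y + (Complex.I * ((-r : ℝ) : ℂ)) • y = 0 := by
    rw [← add_smul]; simp
  have h3 : r ^ 2 * ‖y‖ ^ 2 = 0 := by
    rw [h0] at h2
    simp only [norm_zero] at h2
    nlinarith [sq_nonneg ‖(Complex.I * (r : ℂ)) • y‖, sq_nonneg (r * ‖y‖)]
  have h4 : ‖y‖ ^ 2 = 0 := (mul_eq_zero.mp h3).resolve_left (pow_ne_zero 2 hr)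
  exact norm_eq_zero.mp (pow_eq_zero_iff two_ne_zero |>.mp h4)

theorem addScalar_apply (T : H →ₗ.[ℂ] H) (c : ℂ) (x : T.domain) :
    addScalar T c x = T x + c • (x : H) := rfl

/-- For self-adjoint `T` and real `r ≠ 0` the operator `T + i r` has a bounded inverse. -/
theorem exists_isBoundedInverse_add_I {T : H →ₗ.[ℂ] H} (hT : IsSelfAdjoint T) {r : ℝ}
    (hr : r ≠ 0) : ∃ B, IsBoundedInverse (addScalar T (Complex.I * r)) B := by
  set F : T.domain →ₗ[ℂ] H := (addScalar T (Complex.I * r)).toFun with hF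
  have hFa : ∀ x : T.domain, F x = T x + (Complex.I * r) • (x : H) := fun x => rfl
  have hr' : 0 < |r| := abs_pos.mpr hr
  have hbd : ∀ x : T.domain, |r| * ‖(x : H)‖ ≤ ‖F x‖ := norm_le_add_I hT r
  have hinj : Function.Injective F := by
    rw [injective_iff_map_eq_zero]
    intro x hx
    have h := hbd x
    rw [hx, norm_zero] at h
    have : ‖(x : H)‖ ≤ 0 := by
      by_contra hc
      push Not at hc
      nlinarith [mul_pos hr' hc]
    exact Subtype.ext (norm_le_zero_iff.mp this)
  have hclosed : IsClosed (LinearMap.range F : Set H) := by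
    apply IsSeqClosed.isClosed
    intro y l hy hl
    choose x hx using hy
    have hc : CauchySeq fun n => ((x n : T.domain) : H) := by
      have hcy := hl.cauchySeq
      rw [Metric.cauchySeq_iff'] at hcy ⊢
      intro ε hε
      obtain ⟨N, hN⟩ := hcy (|r| * ε) (mul_pos hr' hε)
      refine ⟨N, fun n hn => ?_⟩
      have h1 := hN n hn
      rw [dist_eq_norm, ← hx, ← hx, ← map_sub] at h1
      have h2 := hbd (x n - x N)
      rw [dist_eq_norm]
      have h3 : |r| * ‖(x n : H) - (x N : H)‖ < |r| * ε := lt_of_le_of_lt h2 h1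
      exact lt_of_mul_lt_mul_left h3 hr'.le
    obtain ⟨z, hz⟩ := cauchySeq_tendsto_of_complete hc
    have hTx : Tendsto (fun n => T (x n)) atTop (𝓝 (l - (Complex.I * r) • z)) := by
      refine (hl.sub (hz.const_smul (Complex.I * (r : ℂ)))).congr fun n => ?_
      rw [← hx, hFa]; abel
    have hg : (z, l - (Complex.I * r) • z) ∈ T.graph := by
      have hcl : IsClosed (T.graph : Set (H × H)) := hT.isClosed
      exact hcl.mem_of_tendsto (hz.prodMk_nhds hTx)
        (Eventually.of_forall fun n => T.mem_graph (x n))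
    rw [LinearPMap.mem_graph_iff] at hg
    obtain ⟨w, hw1, hw2⟩ := hg
    refine ⟨w, ?_⟩
    rw [hFa, hw2]
    simp only at hw1
    rw [hw1, sub_add_cancel]
  have hsurj : LinearMap.range F = ⊤ := by
    have h1 : (LinearMap.range F).topologicalClosure = ⊤ := by
      rw [Submodule.topologicalClosure_eq_top_iff, Submodule.eq_bot_iff]
      intro y hy
      rw [Submodule.mem_orthogonal] at hy
      exact eq_zero_of_inner_range hT hr fun x => hy _ ⟨x, rfl⟩
    rwa [hclosed.submodule_topologicalClosure_eq] at h1
  let e := LinearEquiv.ofBijective F ⟨hinj, LinearMap.range_eq_top.mp hsurj⟩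
  have he : ∀ y, F (e.symm y) = y := fun y => e.apply_symm_apply y
  refine ⟨(T.domain.subtype ∘ₗ e.symm.toLinearMap).mkContinuous |r|⁻¹ fun y => ?_, ?_, ?_⟩
  · have h := hbd (e.symm y)
    rw [he] at h
    rw [inv_mul_eq_div, le_div_iff₀' hr']
    exact h
  · exact fun y => ⟨(e.symm y).2, he y⟩
  · intro x
    exact congrArg Subtype.val (e.symm_apply_apply x)

theorem inverse_add_I_spec {T : H →ₗ.[ℂ] H} (hT : IsSelfAdjoint T) {r : ℝ} (hr : r ≠ 0) :
    IsBoundedInverse (addScalar T (Complex.I * r)) (boundedInverse (addScalar T (Complex.I * r))) :=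
  boundedInverse_spec (exists_isBoundedInverse_add_I hT hr)

/-- For self-adjoint `T` and real `r ≠ 0` the operator `T ^ 2 + r ^ 2` has a bounded inverse,
namely `(T - i r)⁻¹ (T + i r)⁻¹`. -/
theorem isBoundedInverse_square {T : H →ₗ.[ℂ] H} (hT : IsSelfAdjoint T) {r : ℝ} (hr : r ≠ 0) :
    IsBoundedInverse (addScalar (square T) ((r ^ 2 : ℝ) : ℂ))
      (boundedInverse (addScalar T (Complex.I * (-r : ℝ))) ∘L
        boundedInverse (addScalar T (Complex.I * r))) := by
  have hp := inverse_add_I_spec hT hr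
  have hm := inverse_add_I_spec hT (neg_ne_zero.mpr hr)
  set P := boundedInverse (addScalar T (Complex.I * r))
  set M := boundedInverse (addScalar T (Complex.I * (-r : ℝ)))
  have hI : (Complex.I * r) * (Complex.I * r) = -((r ^ 2 : ℝ) : ℂ) := by
    push_cast; linear_combination (r : ℂ) ^ 2 * Complex.I_mul_I
  constructor
  · intro y
    obtain ⟨h1, e1⟩ := hp.1 y
    obtain ⟨h2, e2⟩ := hm.1 (P y)
    change P y ∈ T.domain at h1
    change M (P y) ∈ T.domain at h2
    have e1' : T ⟨P y, h1⟩ = y - (Complex.I * r) • P y := eq_sub_of_add_eq e1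
    have e2' : T ⟨M (P y), h2⟩ = P y + (Complex.I * r) • M (P y) := by
      have : T ⟨M (P y), h2⟩ + (Complex.I * (-r : ℝ)) • M (P y) = P y := e2
      rw [← eq_sub_iff_add_eq] at this
      rw [this]; push_cast; module
    have h3 : T ⟨M (P y), h2⟩ ∈ T.domain :=
      e2' ▸ T.domain.add_mem h1 (T.domain.smul_mem _ h2)
    refine ⟨⟨h2, h3⟩, ?_⟩
    change T ⟨T ⟨M (P y), h2⟩, h3⟩ + ((r ^ 2 : ℝ) : ℂ) • M (P y) = y
    have e3 : T ⟨T ⟨M (P y), h2⟩, h3⟩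
        = T ⟨P y, h1⟩ + (Complex.I * (r : ℂ)) • T ⟨M (P y), h2⟩ := by
      rw [← T.map_smul, ← T.map_add]
      congr 1
      exact Subtype.ext e2'
    rw [e3, e1', e2', smul_add, smul_smul, hI]
    module
  · rintro ⟨x, h, h'⟩
    change M (P (T ⟨T ⟨x, h⟩, h'⟩ + ((r ^ 2 : ℝ) : ℂ) • x)) = x
    have h4 : T ⟨x, h⟩ + (Complex.I * (-r : ℝ)) • x ∈ T.domain :=
      T.domain.add_mem h' (T.domain.smul_mem _ h)
    have e4 : T ⟨_, h4⟩ = T ⟨T ⟨x, h⟩, h'⟩ + (Complex.I * ((-r : ℝ) : ℂ)) • T ⟨x, h⟩ := by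
      rw [← T.map_smul, ← T.map_add]
      rfl
    have e5 : T ⟨T ⟨x, h⟩, h'⟩ + ((r ^ 2 : ℝ) : ℂ) • x
        = addScalar T (Complex.I * r) ⟨_, h4⟩ := by
      have : addScalar T (Complex.I * r) ⟨_, h4⟩
        = T ⟨_, h4⟩ + (Complex.I * r) • (T ⟨x, h⟩ + (Complex.I * (-r : ℝ)) • x) := rfl
      rw [this, e4, smul_add, smul_smul]
      have hI' : (Complex.I * r) * (Complex.I * ((-r : ℝ) : ℂ)) = ((r ^ 2 : ℝ) : ℂ) := by
        push_cast at hI ⊢; linear_combination -hI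
      rw [hI']
      push_cast
      module
    rw [e5, hp.2]
    exact hm.2 ⟨x, h⟩

theorem isBoundedInverse_unique {T : H →ₗ.[ℂ] H} {B B' : H →L[ℂ] H} (h : IsBoundedInverse T B)
    (h' : IsBoundedInverse T B') : B = B' := by
  ext y
  obtain ⟨h1, e1⟩ := h'.1 y
  conv_lhs => rw [← e1]
  exact h.2 _

theorem boundedInverse_square {T : H →ₗ.[ℂ] H} (hT : IsSelfAdjoint T) {r : ℝ} (hr : r ≠ 0) :
    boundedInverse (addScalar (square T) ((r ^ 2 : ℝ) : ℂ))
      = boundedInverse (addScalar T (Complex.I * (-r : ℝ))) ∘L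
        boundedInverse (addScalar T (Complex.I * r)) :=
  isBoundedInverse_unique (boundedInverse_spec ⟨_, isBoundedInverse_square hT hr⟩)
    (isBoundedInverse_square hT hr)

theorem adjoint_inverse_add_I {T : H →ₗ.[ℂ] H} (hT : IsSelfAdjoint T) {r : ℝ} (hr : r ≠ 0) :
    (boundedInverse (addScalar T (Complex.I * r))).adjoint
      = boundedInverse (addScalar T (Complex.I * (-r : ℝ))) := by
  have hp := inverse_add_I_spec hT hr
  have hm := inverse_add_I_spec hT (neg_ne_zero.mpr hr)
  symm
  rw [ContinuousLinearMap.eq_adjoint_iff]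
  intro x y
  obtain ⟨h1, e1⟩ := hp.1 y
  obtain ⟨h2, e2⟩ := hm.1 x
  conv_lhs => rw [← e1]
  conv_rhs => rw [← e2]
  have hs := inner_symm_of_isSelfAdjoint hT ⟨_, h2⟩ ⟨_, h1⟩
  change inner ℂ _ (T ⟨_, h1⟩ + (Complex.I * (r : ℂ)) • _)
    = inner ℂ (T ⟨_, h2⟩ + (Complex.I * ((-r : ℝ) : ℂ)) • _) _
  rw [inner_add_left, inner_add_right, inner_smul_left, inner_smul_right, hs]
  simp

/-- The operator `R ^ 2 (Ω ^ 2 + R ^ 2)⁻¹` is positive, and `Φ_R` is its square root. -/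
theorem cutoff_spec {Ω : H →ₗ.[ℂ] H} (hΩ : IsSelfAdjoint Ω) {R : ℝ} (hR : R ≠ 0) :
    0 ≤ cutoff Ω R ∧ cutoff Ω R * cutoff Ω R
      = ((R ^ 2 : ℝ) : ℂ) • boundedInverse (addScalar (square Ω) ((R ^ 2 : ℝ) : ℂ)) := by
  refine ⟨CFC.sqrt_nonneg _, CFC.sqrt_mul_sqrt_self _ ?_⟩
  rw [boundedInverse_square hΩ hR, ← adjoint_inverse_add_I hΩ hR,
    ContinuousLinearMap.nonneg_iff_isPositive]
  exact (ContinuousLinearMap.isPositive_adjoint_comp_self _).smul_of_nonneg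
    (Complex.zero_le_real.mpr (sq_nonneg R))

theorem norm_cutoff {Ω : H →ₗ.[ℂ] H} (hΩ : IsSelfAdjoint Ω) {R : ℝ} (hR : R ≠ 0) (z : H) :
    ‖cutoff Ω R z‖ = |R| * ‖boundedInverse (addScalar Ω (Complex.I * R)) z‖ := by
  obtain ⟨h0, h1⟩ := cutoff_spec hΩ hR
  have hpos := (ContinuousLinearMap.nonneg_iff_isPositive _).mp h0
  rw [boundedInverse_square hΩ hR, ← adjoint_inverse_add_I hΩ hR] at h1
  have h2 : inner ℂ (cutoff Ω R z) (cutoff Ω R z) =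
      ((R ^ 2 : ℝ) : ℂ) * inner ℂ (boundedInverse (addScalar Ω (Complex.I * R)) z)
        (boundedInverse (addScalar Ω (Complex.I * R)) z) := by
    rw [hpos.inner_left_eq_inner_right]
    have h3 := congrArg (fun B : H →L[ℂ] H => inner ℂ z (B z)) h1
    simp only [smul_apply, ContinuousLinearMap.comp_apply, inner_smul_right,
      ContinuousLinearMap.adjoint_inner_right] at h3
    exact h3
  rw [inner_self_eq_norm_sq_to_K, inner_self_eq_norm_sq_to_K] at h2
  rw [← sq_eq_sq₀ (norm_nonneg _) (by positivity), mul_pow, sq_abs]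
  apply Complex.ofReal_injective
  push_cast at h2 ⊢
  exact h2

/-- `Φ_R` maps into the domain of `Ω`. -/
theorem cutoff_mem_domain {Ω : H →ₗ.[ℂ] H} (hΩ : IsSelfAdjoint Ω) {R : ℝ} (hR : R ≠ 0) (x : H) :
    cutoff Ω R x ∈ Ω.domain := by
  have hpos := (ContinuousLinearMap.nonneg_iff_isPositive _).mp (cutoff_spec hΩ hR).1
  have hp := inverse_add_I_spec hΩ hR
  have key : ∀ y : Ω.domain,
      ‖inner ℂ (cutoff Ω R x) (Ω y + (Complex.I * R) • (y : H))‖ ≤ (‖x‖ * |R|) * ‖y‖ := by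
    intro y
    rw [hpos.inner_left_eq_inner_right]
    refine (norm_inner_le_norm _ _).trans (le_of_eq ?_)
    have e : boundedInverse (addScalar Ω (Complex.I * R)) (Ω y + (Complex.I * R) • (y : H))
        = (y : H) := hp.2 y
    rw [norm_cutoff hΩ hR, e, mul_assoc]
    rfl
  have hadj : Ω.adjoint = Ω := LinearPMap.isSelfAdjoint_def.mp hΩ
  suffices h : cutoff Ω R x ∈ Ω.adjoint.domain from
    (congrArg LinearPMap.domain hadj).le h
  rw [LinearPMap.mem_adjoint_domain_iff]
  refine ((innerₛₗ ℂ (cutoff Ω R x)).comp Ω.toFun).mkContinuous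
    (‖x‖ * |R| + ‖cutoff Ω R x‖ * |R|) (fun y => ?_) |>.continuous
  have h1 := key y
  rw [inner_add_right] at h1
  have h2 : ‖inner ℂ (cutoff Ω R x) ((Complex.I * (R : ℂ)) • (y : H))‖
      ≤ ‖cutoff Ω R x‖ * |R| * ‖y‖ := by
    refine (norm_inner_le_norm _ _).trans (le_of_eq ?_)
    rw [norm_smul]
    simp [mul_assoc]
  have h3 := norm_sub_le (inner ℂ (cutoff Ω R x) (Ω y)
    + inner ℂ (cutoff Ω R x) ((Complex.I * (R : ℂ)) • (y : H)))
    (inner ℂ (cutoff Ω R x) ((Complex.I * (R : ℂ)) • (y : H)))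
  rw [add_sub_cancel_right] at h3
  change ‖inner ℂ (cutoff Ω R x) (Ω y)‖ ≤ _
  linarith

/-- A linear map on `D(Ω)` which is `Ω`-bounded may be composed with any bounded operator which
maps into `D(Ω)`. -/
theorem compBounded_spec {Ω : H₁ →ₗ.[ℂ] H₁} (hΩ : IsSelfAdjoint Ω) {Γ : Ω.domain →ₗ[ℂ] H₀}
    (hΓ : ∃ C : ℝ, ∀ φ : Ω.domain, ‖Γ φ‖ ^ 2 ≤ C * ‖Ω φ + Complex.I • (φ : H₁)‖ ^ 2)
    {B : H₁ →L[ℂ] H₁} (hB : ∀ x, B x ∈ Ω.domain) (x : H₁) :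
    compBounded Γ B x = Γ ⟨B x, hB x⟩ := by
  have hex : ∃ C : H₁ →L[ℂ] H₀, ∀ x, ∃ hx : B x ∈ Ω.domain, C x = Γ ⟨B x, hx⟩ := by
    have hcl : IsClosed (Ω.graph : Set (H₁ × H₁)) := hΩ.isClosed
    let B' : H₁ →ₗ[ℂ] Ω.domain := B.toLinearMap.codRestrict Ω.domain hB
    let L : H₁ →L[ℂ] H₁ := ⟨Ω.toFun ∘ₗ B', by
      apply LinearMap.continuous_of_seq_closed_graph
      intro u a b hu hb
      have hg : (B a, b) ∈ Ω.graph := hcl.mem_of_tendsto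
        (((B.continuous.tendsto a).comp hu).prodMk_nhds hb)
        (Eventually.of_forall fun n => Ω.mem_graph (B' (u n)))
      rw [LinearPMap.mem_graph_iff] at hg
      obtain ⟨w, hw1, hw2⟩ := hg
      refine hw2.symm.trans ?_
      change Ω w = Ω (B' a)
      congr 1
      exact Subtype.ext hw1⟩
    obtain ⟨C, hC⟩ := hΓ
    have hb : ∀ x, ‖(Γ ∘ₗ B') x‖ ≤ (Real.sqrt |C| * ‖L + Complex.I • B‖) * ‖x‖ := by
      intro x
      have h1 := hC (B' x)
      have h2 : ‖Ω (B' x) + Complex.I • (B' x : H₁)‖ ≤ ‖L + Complex.I • B‖ * ‖x‖ :=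
        (L + Complex.I • B).le_opNorm x
      rw [mul_assoc]
      refine le_trans ?_ (mul_le_mul_of_nonneg_left h2 (Real.sqrt_nonneg _))
      apply le_of_sq_le_sq _ (by positivity)
      rw [mul_pow, Real.sq_sqrt (abs_nonneg C)]
      exact h1.trans (mul_le_mul_of_nonneg_right (le_abs_self C) (sq_nonneg _))
    exact ⟨(Γ ∘ₗ B').mkContinuous _ hb, fun x => ⟨hB x, rfl⟩⟩
  rw [compBounded, dif_pos hex]
  exact (hex.choose_spec x).2

theorem opS_spec {Ω : H₁ →ₗ.[ℂ] H₁} (hΩ : IsSelfAdjoint Ω) {Γ : Ω.domain →ₗ[ℂ] H₀}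
    (hΓ : ∃ C : ℝ, ∀ φ : Ω.domain, ‖Γ φ‖ ^ 2 ≤ C * ‖Ω φ + Complex.I • (φ : H₁)‖ ^ 2)
    (φ : Ω.domain) : opS Ω Γ (Ω φ + Complex.I • (φ : H₁)) = Γ φ := by
  have h := inverse_add_I_spec hΩ one_ne_zero
  rw [Complex.ofReal_one, mul_one] at h
  rw [opS, compBounded_spec hΩ hΓ fun x => (h.1 x).1]
  congr 1
  exact Subtype.ext (h.2 φ)

theorem norm_sq_self_le {Ω : H₁ →ₗ.[ℂ] H₁} (hΩ : IsSelfAdjoint Ω) :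
    ∃ C : ℝ, ∀ φ : Ω.domain, ‖Ω.toFun φ‖ ^ 2 ≤ C * ‖Ω φ + Complex.I • (φ : H₁)‖ ^ 2 := by
  refine ⟨1, fun φ => ?_⟩
  have h := norm_sq_add_I hΩ 1 φ
  rw [Complex.ofReal_one, mul_one] at h
  rw [h]
  change ‖Ω φ‖ ^ 2 ≤ _
  nlinarith [sq_nonneg ‖(φ : H₁)‖]

/-- For `R ≠ 0` the entries of `blockApprox` are the compositions which they denote. -/
theorem compBounded_cutoff {Ω : H₁ →ₗ.[ℂ] H₁} (hΩ : IsSelfAdjoint Ω) {Γ : Ω.domain →ₗ[ℂ] H₀}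
    (hΓ : ∃ C : ℝ, ∀ φ : Ω.domain, ‖Γ φ‖ ^ 2 ≤ C * ‖Ω φ + Complex.I • (φ : H₁)‖ ^ 2)
    {R : ℝ} (hR : R ≠ 0) (w : H₁) :
    compBounded Γ (cutoff Ω R) w = Γ ⟨cutoff Ω R w, cutoff_mem_domain hΩ hR w⟩ ∧
      compBounded Ω.toFun (cutoff Ω R) w = Ω ⟨cutoff Ω R w, cutoff_mem_domain hΩ hR w⟩ :=
  ⟨compBounded_spec hΩ hΓ (cutoff_mem_domain hΩ hR) w,
    compBounded_spec hΩ (norm_sq_self_le hΩ) (cutoff_mem_domain hΩ hR) w⟩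

end BlockOperator

end

open Filter Topology
set_option linter.unusedSectionVars false

noncomputable section
namespace BlockOperator
variable {H H₀ H₁ : Type*}
  [NormedAddCommGroup H] [InnerProductSpace ℂ H] [CompleteSpace H]
  [NormedAddCommGroup H₀] [InnerProductSpace ℂ H₀] [CompleteSpace H₀]
  [NormedAddCommGroup H₁] [InnerProductSpace ℂ H₁] [CompleteSpace H₁]

/-! ### Criteria for self-adjointness and the Kato–Rellich theorem -/

/-! On `D(Ω)` one has `Γ = S (Ω + i)`, so `Γ Φ_R = S (Ω + i) Φ_R` and `(Γ Φ_R)† = (Ω - i) Φ_R S†`.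
The second entry of the approximants is therefore `Ω Φ_R (w + S† v) - i Φ_R S† v`. Since `Φ_R → 1`
strongly and `Ω` is closed, `Ω Φ_R x` converges exactly when `x ∈ D(Ω)`. Hence the second entry
converges if and only if `w = φ - S† v` with `φ ∈ D(Ω)`. The first entry then converges too, because
`Γ Φ_R φ → Γ φ` and `Γ Φ_R S† v → G v`. This gives both descriptions of the domain and the formula
`(v, φ - S† v) ↦ (A v + Γ φ - G v, Ω φ - i S† v)` (`tendsto_blockApprox`).

Symmetry of `𝒜` is inherited from the approximants. It remains to show that `D(𝒜†)` is no larger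
than `D(𝒜)`. Testing the adjoint relation for `(y₀, y₁)` against vectors with `v = 0` gives `y₁ + S†
y₀ ∈ D(Ω† ) = D(Ω)`. Testing against `φ = 0` puts `y₀` in the adjoint domain of `A - G + i S S†`.
That operator is self-adjoint on `D(A)` by Kato–Rellich: `G - i S S†` is the strong limit on `D(A)`
of the symmetric operators `S Ω Φ_R S†`, and the estimate on `G` gives relative bound less than one,
as `S S†` is bounded. So `y₀ ∈ D(A)` (`mem_domain_of_inner_block_eq`). -/

/-- A densely defined symmetric operator whose adjoint has no larger domain is self-adjoint. -/
theorem isSelfAdjoint_of_adjoint_domain_le {T : H →ₗ.[ℂ] H} (hd : Dense (T.domain : Set H))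
    (hs : ∀ x y : T.domain, inner ℂ (T x) (y : H) = inner ℂ (x : H) (T y))
    (hT : ∀ y z : H, (∀ x : T.domain, inner ℂ z (x : H) = inner ℂ y (T x)) → y ∈ T.domain) :
    IsSelfAdjoint T := by
  have hle : T ≤ T.adjoint :=
    LinearPMap.IsFormalAdjoint.le_adjoint hd (fun x y => hs x y)
  refine LinearPMap.isSelfAdjoint_def.mpr (LinearPMap.eq_of_le_of_domain_eq hle ?_).symm
  refine le_antisymm hle.1 fun y hy => hT y (T.adjoint ⟨y, hy⟩) fun x => ?_
  exact LinearPMap.adjoint_isFormalAdjoint hd ⟨y, hy⟩ x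

/-- A densely defined symmetric operator `T` such that `T + i r` and `T - i r` are surjective is
self-adjoint. -/
theorem isSelfAdjoint_of_surjective {T : H →ₗ.[ℂ] H} (hd : Dense (T.domain : Set H))
    (hs : ∀ x y : T.domain, inner ℂ (T x) (y : H) = inner ℂ (x : H) (T y)) {r : ℝ}
    (hp : ∀ y, ∃ x : T.domain, T x + (Complex.I * r) • (x : H) = y)
    (hm : ∀ y, ∃ x : T.domain, T x + (Complex.I * (-r : ℝ)) • (x : H) = y) :
    IsSelfAdjoint T := by
  refine isSelfAdjoint_of_adjoint_domain_le hd hs fun y z hyz => ?_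
  -- If `y` lies in the domain with `T y = z`, then `x = y`. In general `y - x` is orthogonal to the
  -- range of `T - i r`, which is everything, so `y - x` is orthogonal to itself.
  obtain ⟨x, hx⟩ := hp (z + (Complex.I * r) • y)
  suffices h : y - x = 0 from sub_eq_zero.mp h ▸ x.2
  obtain ⟨u, hu⟩ := hm (y - x)
  rw [← inner_self_eq_zero (𝕜 := ℂ)]
  nth_rw 2 [← hu]
  have h1 := hyz u
  have h2 := hs x u
  have h3 := congrArg (fun w => inner ℂ w (u : H)) hx
  simp only [inner_add_left, inner_smul_left, map_mul, Complex.conj_I, Complex.conj_ofReal] at h3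
  simp only [inner_sub_left, inner_add_right, inner_smul_right]
  push_cast
  linear_combination h2 - h3 - h1

/-- The sum of an operator `T` and an operator `B` defined on the domain of `T`. -/
def addOnDomain (T : H →ₗ.[ℂ] H) (B : T.domain →ₗ[ℂ] H) : H →ₗ.[ℂ] H where
  domain := T.domain
  toFun := T.toFun + B

theorem norm_le_norm_add_I {T : H →ₗ.[ℂ] H} (hT : IsSelfAdjoint T) (r : ℝ) (x : T.domain) :
    ‖T x‖ ≤ ‖T x + (Complex.I * r) • (x : H)‖ := by
  apply le_of_sq_le_sq _ (norm_nonneg _)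
  rw [norm_sq_add_I hT]
  nlinarith [sq_nonneg (r * ‖(x : H)‖)]

/-- Factor `T + B + i r = (1 + K) (T + i r)` with `K = B (T + i r)⁻¹`. The bound on `B` makes `‖K‖ <
1`, so `1 + K` is invertible by the Neumann series. -/
theorem surjective_addOnDomain {T : H →ₗ.[ℂ] H} (hT : IsSelfAdjoint T) (B : T.domain →ₗ[ℂ] H)
    {a b r : ℝ} (hb : 0 ≤ b) (hr : r ≠ 0) (hab : a + b / |r| < 1)
    (hB : ∀ x : T.domain, ‖B x‖ ≤ a * ‖T x + (Complex.I * r) • (x : H)‖ + b * ‖(x : H)‖) (y : H) :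
    ∃ x : T.domain, addOnDomain T B x + (Complex.I * r) • (x : H) = y := by
  have hP := inverse_add_I_spec hT hr
  set P := boundedInverse (addScalar T (Complex.I * r))
  have hPm : ∀ z, P z ∈ T.domain := fun z => (hP.1 z).1
  have hPe : ∀ z, T ⟨P z, hPm z⟩ + (Complex.I * r) • P z = z := fun z => (hP.1 z).2
  -- The sign of `a` is not prescribed here, and an operator norm bound must be nonnegative.
  let c := max (a + b / |r|) 0
  have hr' : 0 < |r| := abs_pos.mpr hr
  have hbd : ∀ z, ‖(B ∘ₗ P.toLinearMap.codRestrict T.domain hPm) z‖ ≤ c * ‖z‖ := by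
    intro z
    have h1 := hB ⟨P z, hPm z⟩
    have h2 := norm_le_add_I hT r ⟨P z, hPm z⟩
    rw [hPe] at h1 h2
    have h3 : ‖P z‖ ≤ ‖z‖ / |r| := by rwa [le_div_iff₀' hr']
    have h4 : b * ‖P z‖ ≤ b * (‖z‖ / |r|) := mul_le_mul_of_nonneg_left h3 hb
    calc _ ≤ a * ‖z‖ + b * ‖P z‖ := h1
      _ ≤ a * ‖z‖ + b * (‖z‖ / |r|) := by linarith
      _ = (a + b / |r|) * ‖z‖ := by ring
      _ ≤ c * ‖z‖ := mul_le_mul_of_nonneg_right (le_max_left _ _) (norm_nonneg _)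
  let K : H →L[ℂ] H := (B ∘ₗ P.toLinearMap.codRestrict T.domain hPm).mkContinuous c hbd
  have hK : ‖-K‖ < 1 := by
    rw [norm_neg]
    exact (LinearMap.mkContinuous_norm_le _ (le_max_right _ _) hbd).trans_lt
      (max_lt hab one_pos)
  obtain ⟨u, hu⟩ := isUnit_one_sub_of_norm_lt_one hK
  have hz : (u : H →L[ℂ] H) ((↑u⁻¹ : H →L[ℂ] H) y) = y := by
    rw [← mul_apply_eq_comp, Units.mul_inv, one_apply_eq_self]
  rw [hu, sub_neg_eq_add] at hz
  set z := (↑u⁻¹ : H →L[ℂ] H) y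
  refine ⟨⟨P z, hPm z⟩, ?_⟩
  change T ⟨P z, hPm z⟩ + B ⟨P z, hPm z⟩ + (Complex.I * r) • P z = y
  rw [add_right_comm, hPe]
  exact hz

/-- The **Kato–Rellich theorem**: the sum of a self-adjoint operator `T` and a symmetric operator
which is `T`-bounded with relative bound less than one is self-adjoint. -/
theorem isSelfAdjoint_addOnDomain {T : H →ₗ.[ℂ] H} (hT : IsSelfAdjoint T) (B : T.domain →ₗ[ℂ] H)
    (hs : ∀ x y : T.domain, inner ℂ (B x) (y : H) = inner ℂ (x : H) (B y)) {a b : ℝ}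
    (ha : 0 ≤ a) (ha1 : a < 1)
    (hB : ∀ x : T.domain, ‖B x‖ ≤ a * ‖T x‖ + b * ‖(x : H)‖) :
    IsSelfAdjoint (addOnDomain T B) := by
  obtain ⟨r, hr, hab⟩ : ∃ r : ℝ, 0 < r ∧ a + |b| / r < 1 := by
    -- With this `r`, `|b| / r = (1 - a) |b| / (|b| + 1) < 1 - a`.
    refine ⟨(|b| + 1) / (1 - a), div_pos (by positivity) (by linarith), ?_⟩
    have h1 : (0 : ℝ) < |b| + 1 := by positivity
    have h2 : 0 < 1 - a := by linarith
    rw [div_div_eq_mul_div, ← lt_sub_iff_add_lt', div_lt_iff₀ h1]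
    nlinarith
  have hbd : ∀ (s : ℝ) (x : T.domain),
      ‖B x‖ ≤ a * ‖T x + (Complex.I * s) • (x : H)‖ + |b| * ‖(x : H)‖ := fun s x =>
    (hB x).trans (add_le_add
      (mul_le_mul_of_nonneg_left (norm_le_norm_add_I hT s x) ha)
      (mul_le_mul_of_nonneg_right (le_abs_self b) (norm_nonneg _)))
  refine isSelfAdjoint_of_surjective hT.dense_domain (fun x y => ?_) (r := r)
    (surjective_addOnDomain hT B (abs_nonneg b) hr.ne' (by rwa [abs_of_pos hr]) (hbd r))
    (surjective_addOnDomain hT B (abs_nonneg b) (neg_ne_zero.mpr hr.ne')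
      (by rwa [abs_neg, abs_of_pos hr]) (hbd (-r)))
  have h1 := hs x y
  have h2 := inner_symm_of_isSelfAdjoint hT x y
  refine (inner_add_left _ _ _).trans (Eq.trans ?_ (inner_add_right _ _ _).symm)
  exact congrArg₂ (· + ·) h2 h1

/-! ### The cutoff -/

/-- Both orders of the product of `(Ω + i R)⁻¹` and `(Ω - i R)⁻¹` invert `Ω ^ 2 + R ^ 2`, so the two
resolvents commute. Thus `(Ω + i R)⁻¹` commutes with `Φ_R ^ 2`, and with its square root by the
functional calculus. -/
theorem commute_cutoff_inverse {Ω : H →ₗ.[ℂ] H} (hΩ : IsSelfAdjoint Ω) {R : ℝ} (hR : R ≠ 0) :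
    Commute (cutoff Ω R) (boundedInverse (addScalar Ω (Complex.I * R))) := by
  have h1 := boundedInverse_square hΩ hR
  have h2 := boundedInverse_square hΩ (neg_ne_zero.mpr hR)
  rw [neg_neg, neg_sq, h1] at h2
  set P := boundedInverse (addScalar Ω (Complex.I * R))
  set M := boundedInverse (addScalar Ω (Complex.I * (-R : ℝ)))
  have h3 : Commute M P := h2
  rw [cutoff, CFC.sqrt]
  refine Commute.cfcₙ_nnreal ?_ _
  rw [h1]
  exact (Commute.mul_left h3 (Commute.refl P)).smul_left _

/-- `Ω Φ_R = Φ_R Ω` on the domain of `Ω`. -/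
theorem apply_cutoff {Ω : H →ₗ.[ℂ] H} (hΩ : IsSelfAdjoint Ω) {R : ℝ} (hR : R ≠ 0)
    (φ : Ω.domain) :
    Ω ⟨cutoff Ω R φ, cutoff_mem_domain hΩ hR φ⟩ = cutoff Ω R (Ω φ) := by
  have hP := inverse_add_I_spec hΩ hR
  have hc := commute_cutoff_inverse hΩ hR
  set P := boundedInverse (addScalar Ω (Complex.I * R))
  have h1 : P (Ω φ + (Complex.I * R) • (φ : H)) = φ := hP.2 φ
  have h2 : cutoff Ω R φ = P (cutoff Ω R (Ω φ + (Complex.I * R) • (φ : H))) := by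
    conv_lhs => rw [← h1]
    exact DFunLike.congr_fun hc.eq _
  obtain ⟨h3, h4⟩ := hP.1 (cutoff Ω R (Ω φ + (Complex.I * R) • (φ : H)))
  have h5 : Ω ⟨cutoff Ω R φ, cutoff_mem_domain hΩ hR φ⟩ + (Complex.I * R) • cutoff Ω R φ
      = cutoff Ω R (Ω φ + (Complex.I * R) • (φ : H)) := by
    refine Eq.trans ?_ h4
    exact congrArg (addScalar Ω (Complex.I * R)) (Subtype.ext h2)
  rw [map_add, map_smul] at h5
  exact add_right_cancel h5

theorem norm_inverse_add_I_le {Ω : H →ₗ.[ℂ] H} (hΩ : IsSelfAdjoint Ω) {R : ℝ} (hR : R ≠ 0)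
    (z : H) : |R| * ‖boundedInverse (addScalar Ω (Complex.I * R)) z‖ ≤ ‖z‖ := by
  obtain ⟨h, e⟩ := (inverse_add_I_spec hΩ hR).1 z
  exact (norm_le_add_I hΩ R ⟨_, h⟩).trans_eq (congrArg norm e)

theorem norm_cutoff_le {Ω : H →ₗ.[ℂ] H} (hΩ : IsSelfAdjoint Ω) {R : ℝ} (hR : R ≠ 0) (z : H) :
    ‖cutoff Ω R z‖ ≤ ‖z‖ :=
  (norm_cutoff hΩ hR z).trans_le (norm_inverse_add_I_le hΩ hR z)

theorem inverse_add_I_apply {Ω : H →ₗ.[ℂ] H} (hΩ : IsSelfAdjoint Ω) {R : ℝ} (hR : R ≠ 0)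
    (φ : Ω.domain) : boundedInverse (addScalar Ω (Complex.I * R)) (Ω φ)
      = φ - (Complex.I * R) • boundedInverse (addScalar Ω (Complex.I * R)) φ := by
  rw [eq_sub_iff_add_eq, ← map_smul, ← map_add]
  exact (inverse_add_I_spec hΩ hR).2 φ

/-- On the domain of `Ω` the cutoff differs from the identity by `O(1 / R)`. -/
theorem norm_sub_cutoff_le {Ω : H →ₗ.[ℂ] H} (hΩ : IsSelfAdjoint Ω) {R : ℝ} (hR : R ≠ 0)
    (φ : Ω.domain) : |R| * ‖(φ : H) - cutoff Ω R φ‖ ≤ 2 * ‖Ω φ‖ := by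
  obtain ⟨h0, hsq⟩ := cutoff_spec hΩ hR
  have hpos := (ContinuousLinearMap.nonneg_iff_isPositive _).mp h0
  have hR' : 0 < |R| := abs_pos.mpr hR
  set z := (φ : H) - cutoff Ω R φ with hz
  -- Positivity of `Φ_R` gives `‖z‖ ≤ ‖(1 + Φ_R) z‖`, and `(1 + Φ_R) (1 - Φ_R) = 1 - Φ_R ^ 2`. This
  -- replaces the square root by an expression in resolvents.
  have h1 : ‖z‖ ≤ ‖z + cutoff Ω R z‖ := by
    apply le_of_sq_le_sq _ (norm_nonneg _)
    rw [norm_add_sq (𝕜 := ℂ)]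
    nlinarith [hpos.re_inner_nonneg_right z, sq_nonneg ‖cutoff Ω R z‖]
  have h2 : z + cutoff Ω R z = (φ : H) - (cutoff Ω R * cutoff Ω R) φ := by
    rw [hz, map_sub, mul_apply_eq_comp]; abel
  have hP := inverse_add_I_apply hΩ hR φ
  have hM := inverse_add_I_apply hΩ (neg_ne_zero.mpr hR) φ
  have nP := norm_inverse_add_I_le hΩ hR (Ω φ)
  have nM := norm_inverse_add_I_le hΩ (neg_ne_zero.mpr hR)
  rw [hsq, boundedInverse_square hΩ hR] at h2
  set P := boundedInverse (addScalar Ω (Complex.I * R))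
  set M := boundedInverse (addScalar Ω (Complex.I * (-R : ℝ)))
  -- Each of the two terms on the right has norm at most `‖Ω φ‖ / |R|`, whence the factor 2.
  have h3 : z + cutoff Ω R z = M (Ω φ) + (Complex.I * (-R : ℝ)) • M (P (Ω φ)) := by
    rw [h2, hM, hP, map_sub, map_smul, smul_sub, smul_smul]
    have : Complex.I * ((-R : ℝ) : ℂ) * (Complex.I * R) = ((R ^ 2 : ℝ) : ℂ) := by
      push_cast; linear_combination (-(R : ℂ) ^ 2) * Complex.I_mul_I
    rw [this]
    change _ - ((R ^ 2 : ℝ) : ℂ) • M (P φ) = _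
    abel
  rw [h3] at h1
  have h4 := norm_add_le (M (Ω φ)) ((Complex.I * (-R : ℝ)) • M (P (Ω φ)))
  have h5 : ‖(Complex.I * ((-R : ℝ) : ℂ)) • M (P (Ω φ))‖ = |-R| * ‖M (P (Ω φ))‖ := by
    rw [norm_smul]; simp
  rw [h5] at h4
  have h6 := nM (P (Ω φ))
  have h7 := nM (Ω φ)
  rw [abs_neg] at h4 h6 h7
  nlinarith [mul_le_mul_of_nonneg_left (h1.trans h4) hR'.le,
    mul_le_mul_of_nonneg_left h6 hR'.le]

/-- The cutoff converges strongly to the identity. -/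
theorem tendsto_cutoff {Ω : H →ₗ.[ℂ] H} (hΩ : IsSelfAdjoint Ω) (z : H) :
    Tendsto (fun R => cutoff Ω R z) atTop (𝓝 z) := by
  rw [Metric.tendsto_atTop]
  intro ε hε
  obtain ⟨φ, hφ, hzφ⟩ := Metric.mem_closure_iff.mp (hΩ.dense_domain z) (ε / 4) (by linarith)
  -- Past this threshold `2 ‖Ω φ‖ / R < ε / 4`, and the summand 1 keeps `R` positive. Three errors
  -- below `ε / 4` remain.
  refine ⟨8 * ‖Ω ⟨φ, hφ⟩‖ / ε + 1, fun R hR => ?_⟩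
  have hR0 : 0 < R := lt_of_lt_of_le (by positivity) hR
  have h1 := norm_sub_cutoff_le hΩ hR0.ne' ⟨φ, hφ⟩
  have h2 := norm_cutoff_le hΩ hR0.ne' (z - φ)
  rw [abs_of_pos hR0] at h1
  rw [dist_eq_norm] at hzφ ⊢
  have h3 : 8 * ‖Ω ⟨φ, hφ⟩‖ < R * ε := by
    rw [← div_lt_iff₀ hε]; linarith
  have h4 : ‖φ - cutoff Ω R φ‖ < ε / 4 := by
    by_contra hc
    push Not at hc
    nlinarith [mul_le_mul_of_nonneg_left hc hR0.le]
  have h5 : cutoff Ω R z - z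
      = cutoff Ω R (z - φ) - (φ - cutoff Ω R φ) - (z - φ) := by
    rw [map_sub]; abel
  rw [h5]
  have h6 := norm_sub_le (cutoff Ω R (z - φ) - (φ - cutoff Ω R φ)) (z - φ)
  have h7 := norm_sub_le (cutoff Ω R (z - φ)) (φ - cutoff Ω R φ)
  linarith

/-! ### The entries of the block operator -/

section entries

variable {A : H₀ →ₗ.[ℂ] H₀} {Ω : H₁ →ₗ.[ℂ] H₁} {Γ : Ω.domain →ₗ[ℂ] H₀}

theorem compBounded_toFun_cutoff (hΩ : IsSelfAdjoint Ω) {R : ℝ} (hR : R ≠ 0) (w : H₁) :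
    compBounded Ω.toFun (cutoff Ω R) w = Ω ⟨cutoff Ω R w, cutoff_mem_domain hΩ hR w⟩ :=
  compBounded_spec hΩ (norm_sq_self_le hΩ) (cutoff_mem_domain hΩ hR) w

/-- Trades the unbounded `Γ` for the bounded `S`, so that limits and adjoints involving `Γ Φ_R`
reduce to those of `Φ_R` and `Ω Φ_R`. -/
theorem compBounded_cutoff_eq_opS (hΩ : IsSelfAdjoint Ω)
    (hΓ : ∃ C : ℝ, ∀ φ : Ω.domain, ‖Γ φ‖ ^ 2 ≤ C * ‖Ω φ + Complex.I • (φ : H₁)‖ ^ 2)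
    {R : ℝ} (hR : R ≠ 0) (w : H₁) :
    compBounded Γ (cutoff Ω R) w
      = opS Ω Γ (compBounded Ω.toFun (cutoff Ω R) w + Complex.I • cutoff Ω R w) := by
  rw [(compBounded_cutoff hΩ hΓ hR w).1, compBounded_toFun_cutoff hΩ hR]
  exact (opS_spec hΩ hΓ ⟨_, cutoff_mem_domain hΩ hR w⟩).symm

/-- `Ω Φ_R` is a bounded self-adjoint operator. -/
theorem inner_compBounded_toFun_cutoff (hΩ : IsSelfAdjoint Ω) {R : ℝ} (hR : R ≠ 0) (x y : H₁) :
    inner ℂ (compBounded Ω.toFun (cutoff Ω R) x) y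
      = inner ℂ x (compBounded Ω.toFun (cutoff Ω R) y) := by
  have hpos := (ContinuousLinearMap.nonneg_iff_isPositive _).mp (cutoff_spec hΩ hR).1
  have hd := hΩ.dense_domain
  set K := compBounded Ω.toFun (cutoff Ω R) with hK
  have h1 : ∀ (φ : Ω.domain) (y : H₁), inner ℂ (K φ) y = inner ℂ (φ : H₁) (K y) := by
    intro φ y
    rw [hK, compBounded_toFun_cutoff hΩ hR, compBounded_toFun_cutoff hΩ hR, apply_cutoff hΩ hR,
      hpos.inner_left_eq_inner_right]
    exact inner_symm_of_isSelfAdjoint hΩ φ ⟨_, cutoff_mem_domain hΩ hR y⟩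
  have h2 : (fun x => inner ℂ (K x) y) = fun x => inner ℂ x (K y) :=
    Continuous.ext_on hd (by fun_prop) (by fun_prop) fun φ hφ => h1 ⟨φ, hφ⟩ y
  exact congrFun h2 x

/-- `(Γ Φ_R)† = (Ω Φ_R - i Φ_R) S†`. -/
theorem adjoint_compBounded_cutoff (hΩ : IsSelfAdjoint Ω)
    (hΓ : ∃ C : ℝ, ∀ φ : Ω.domain, ‖Γ φ‖ ^ 2 ≤ C * ‖Ω φ + Complex.I • (φ : H₁)‖ ^ 2)
    {R : ℝ} (hR : R ≠ 0) (v : H₀) :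
    (compBounded Γ (cutoff Ω R)).adjoint v
      = compBounded Ω.toFun (cutoff Ω R) ((opS Ω Γ).adjoint v)
        - Complex.I • cutoff Ω R ((opS Ω Γ).adjoint v) := by
  have hpos := (ContinuousLinearMap.nonneg_iff_isPositive _).mp (cutoff_spec hΩ hR).1
  refine ext_inner_right ℂ fun w => ?_
  rw [ContinuousLinearMap.adjoint_inner_left, compBounded_cutoff_eq_opS hΩ hΓ hR,
    ← ContinuousLinearMap.adjoint_inner_left, inner_add_right, inner_sub_left, inner_smul_left,
    inner_smul_right, inner_compBounded_toFun_cutoff hΩ hR, hpos.inner_left_eq_inner_right,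
    Complex.conj_I]
  ring

theorem tendsto_compBounded_toFun_cutoff (hΩ : IsSelfAdjoint Ω) (φ : Ω.domain) :
    Tendsto (fun R => compBounded Ω.toFun (cutoff Ω R) (φ : H₁)) atTop (𝓝 (Ω φ)) := by
  refine (tendsto_cutoff hΩ (Ω φ)).congr' ?_
  filter_upwards [eventually_ne_atTop (0 : ℝ)] with R hR
  rw [compBounded_toFun_cutoff hΩ hR, apply_cutoff hΩ hR]

/-- The points `(Φ_R w, Ω Φ_R w)` of the closed graph of `Ω` converge to `(w, L)`. -/
theorem mem_domain_of_tendsto (hΩ : IsSelfAdjoint Ω) {w L : H₁}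
    (h : Tendsto (fun R => compBounded Ω.toFun (cutoff Ω R) w) atTop (𝓝 L)) : w ∈ Ω.domain := by
  have hcl : IsClosed (Ω.graph : Set (H₁ × H₁)) := hΩ.isClosed
  refine Ω.mem_domain_of_mem_graph (y := L) (hcl.mem_of_tendsto
    ((tendsto_cutoff hΩ w).prodMk_nhds h) ?_)
  filter_upwards [eventually_ne_atTop (0 : ℝ)] with R hR
  rw [compBounded_toFun_cutoff hΩ hR]
  exact Ω.mem_graph ⟨_, cutoff_mem_domain hΩ hR w⟩

theorem tendsto_compBounded_cutoff (hΩ : IsSelfAdjoint Ω)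
    (hΓ : ∃ C : ℝ, ∀ φ : Ω.domain, ‖Γ φ‖ ^ 2 ≤ C * ‖Ω φ + Complex.I • (φ : H₁)‖ ^ 2)
    (φ : Ω.domain) :
    Tendsto (fun R => compBounded Γ (cutoff Ω R) (φ : H₁)) atTop (𝓝 (Γ φ)) := by
  rw [← opS_spec hΩ hΓ φ]
  refine (((opS Ω Γ).continuous.tendsto _).comp ((tendsto_compBounded_toFun_cutoff hΩ φ).add
    ((tendsto_cutoff hΩ (φ : H₁)).const_smul Complex.I))).congr' ?_
  filter_upwards [eventually_ne_atTop (0 : ℝ)] with R hR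
  exact (compBounded_cutoff_eq_opS hΩ hΓ hR _).symm

/-- The second entry of `blockApprox` in terms of `w + S† v`. -/
theorem adjoint_add_eq (hΩ : IsSelfAdjoint Ω)
    (hΓ : ∃ C : ℝ, ∀ φ : Ω.domain, ‖Γ φ‖ ^ 2 ≤ C * ‖Ω φ + Complex.I • (φ : H₁)‖ ^ 2)
    {R : ℝ} (hR : R ≠ 0) (v : H₀) (w : H₁) :
    (compBounded Γ (cutoff Ω R)).adjoint v + compBounded Ω.toFun (cutoff Ω R) w
      = compBounded Ω.toFun (cutoff Ω R) (w + (opS Ω Γ).adjoint v)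
        - Complex.I • cutoff Ω R ((opS Ω Γ).adjoint v) := by
  rw [adjoint_compBounded_cutoff hΩ hΓ hR, map_add]
  abel

/-- The second entry of `blockApprox` converges if and only if `w + S† v` is in `D(Ω)`. -/
theorem exists_tendsto_adjoint_add_iff (hΩ : IsSelfAdjoint Ω)
    (hΓ : ∃ C : ℝ, ∀ φ : Ω.domain, ‖Γ φ‖ ^ 2 ≤ C * ‖Ω φ + Complex.I • (φ : H₁)‖ ^ 2)
    (v : H₀) (w : H₁) :
    (∃ L : H₁, Tendsto (fun R : ℝ => (compBounded Γ (cutoff Ω R)).adjoint v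
      + compBounded Ω.toFun (cutoff Ω R) w) atTop (𝓝 L)) ↔
      w + (opS Ω Γ).adjoint v ∈ Ω.domain := by
  have hc := (tendsto_cutoff hΩ ((opS Ω Γ).adjoint v)).const_smul Complex.I
  constructor
  · rintro ⟨L, hL⟩
    refine mem_domain_of_tendsto hΩ ((hL.add hc).congr' ?_)
    filter_upwards [eventually_ne_atTop (0 : ℝ)] with R hR
    rw [adjoint_add_eq hΩ hΓ hR, sub_add_cancel]
  · intro h
    refine ⟨_, ((tendsto_compBounded_toFun_cutoff hΩ ⟨_, h⟩).sub hc).congr' ?_⟩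
    filter_upwards [eventually_ne_atTop (0 : ℝ)] with R hR
    rw [adjoint_add_eq hΩ hΓ hR]

/-- The block operator acts on `(v, φ - S† v)` by
`(v, φ - S† v) ↦ (A v + (Γ φ - G v), Ω φ - i S† v)`. -/
theorem tendsto_blockApprox (hΩ : IsSelfAdjoint Ω)
    (hΓ : ∃ C : ℝ, ∀ φ : Ω.domain, ‖Γ φ‖ ^ 2 ≤ C * ‖Ω φ + Complex.I • (φ : H₁)‖ ^ 2)
    (v : A.domain) (φ : Ω.domain) {g : H₀}
    (hg : Tendsto (fun R : ℝ => compBounded Γ (cutoff Ω R) ((opS Ω Γ).adjoint (v : H₀)))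
      atTop (𝓝 g)) :
    Tendsto (blockApprox A Ω Γ v ((φ : H₁) - (opS Ω Γ).adjoint (v : H₀))) atTop
      (𝓝 (WithLp.toLp 2 (A v + (Γ φ - g), Ω φ - Complex.I • (opS Ω Γ).adjoint (v : H₀)))) := by
  have h1 : Tendsto (fun R => A v
      + compBounded Γ (cutoff Ω R) ((φ : H₁) - (opS Ω Γ).adjoint (v : H₀))) atTop
      (𝓝 (A v + (Γ φ - g))) := by
    simp only [map_sub]
    exact ((tendsto_compBounded_cutoff hΩ hΓ φ).sub hg).const_add _
  have h2 : Tendsto (fun R => (compBounded Γ (cutoff Ω R)).adjoint (v : H₀)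
      + compBounded Ω.toFun (cutoff Ω R) ((φ : H₁) - (opS Ω Γ).adjoint (v : H₀))) atTop
      (𝓝 (Ω φ - Complex.I • (opS Ω Γ).adjoint (v : H₀))) := by
    refine ((tendsto_compBounded_toFun_cutoff hΩ φ).sub
      ((tendsto_cutoff hΩ ((opS Ω Γ).adjoint (v : H₀))).const_smul Complex.I)).congr' ?_
    filter_upwards [eventually_ne_atTop (0 : ℝ)] with R hR
    rw [adjoint_add_eq hΩ hΓ hR, sub_add_cancel]
  exact ((WithLp.prod_continuous_toLp 2 H₀ H₁).tendsto _).comp (h1.prodMk_nhds h2)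

/-- Only the second entry constrains `w`: once it converges, the limit defining `G` forces the first
entry to converge. -/
theorem mem_blockOperator_domain_iff (hΩ : IsSelfAdjoint Ω)
    (hΓ : ∃ C : ℝ, ∀ φ : Ω.domain, ‖Γ φ‖ ^ 2 ≤ C * ‖Ω φ + Complex.I • (φ : H₁)‖ ^ 2)
    (hG : ∀ v : A.domain, ∃ g, Tendsto
      (fun R : ℝ => compBounded Γ (cutoff Ω R) ((opS Ω Γ).adjoint (v : H₀))) atTop (𝓝 g))
    (V : WithLp 2 (H₀ × H₁)) :
    V ∈ (blockOperator A Ω Γ).domain ↔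
      V.fst ∈ A.domain ∧ V.snd + (opS Ω Γ).adjoint V.fst ∈ Ω.domain := by
  constructor
  · rintro ⟨h, L, hL⟩
    exact ⟨h, (exists_tendsto_adjoint_add_iff hΩ hΓ _ _).mp
      ⟨L.snd, ((WithLp.sndL 2 ℂ H₀ H₁).continuous.tendsto L).comp hL⟩⟩
  · rintro ⟨h, h'⟩
    obtain ⟨g, hg⟩ := hG ⟨V.fst, h⟩
    have := tendsto_blockApprox hΩ hΓ ⟨V.fst, h⟩ ⟨_, h'⟩ hg
    simp only [add_sub_cancel_right] at this
    exact ⟨h, _, this⟩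

/-- The off-diagonal entries are mutually adjoint and the diagonal ones, `A` and `Ω Φ_R`, are
symmetric. -/
theorem inner_blockApprox (hA : IsSelfAdjoint A) (hΩ : IsSelfAdjoint Ω) {R : ℝ} (hR : R ≠ 0)
    (v v' : A.domain) (w w' : H₁) :
    inner ℂ (blockApprox A Ω Γ v w R) (WithLp.toLp 2 ((v' : H₀), w'))
      = inner ℂ (WithLp.toLp 2 ((v : H₀), w)) (blockApprox A Ω Γ v' w' R) := by
  simp only [blockApprox, WithLp.prod_inner_apply, inner_add_left, inner_add_right,
    inner_symm_of_isSelfAdjoint hA, inner_compBounded_toFun_cutoff hΩ hR,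
    ContinuousLinearMap.adjoint_inner_left, ContinuousLinearMap.adjoint_inner_right]
  ring

theorem inner_blockOperator (hA : IsSelfAdjoint A) (hΩ : IsSelfAdjoint Ω)
    (V W : (blockOperator A Ω Γ).domain) :
    inner ℂ (blockOperator A Ω Γ V) (W : WithLp 2 (H₀ × H₁))
      = inner ℂ (V : WithLp 2 (H₀ × H₁)) (blockOperator A Ω Γ W) := by
  have h1 := (tendsto_blockOperator A Ω Γ V).inner (𝕜 := ℂ)
    (tendsto_const_nhds (x := (W : WithLp 2 (H₀ × H₁))))
  have h2 := (tendsto_const_nhds (x := (V : WithLp 2 (H₀ × H₁)))).inner (𝕜 := ℂ)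
    (tendsto_blockOperator A Ω Γ W)
  refine tendsto_nhds_unique_of_eventuallyEq h1 h2 ?_
  filter_upwards [eventually_ne_atTop (0 : ℝ)] with R hR
  exact inner_blockApprox hA hΩ hR ⟨V.1.fst, V.2.1⟩ ⟨W.1.fst, W.2.1⟩ V.1.snd W.1.snd

end entries

/-! ### Self-adjointness of the block operator -/

section selfAdjoint

variable {A : H₀ →ₗ.[ℂ] H₀} {Ω : H₁ →ₗ.[ℂ] H₁} {Γ : Ω.domain →ₗ[ℂ] H₀}

/-- `S Ω Φ_R S† v → G v - i S S† v`. -/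
theorem tendsto_opS_adjoint (hΩ : IsSelfAdjoint Ω)
    (hΓ : ∃ C : ℝ, ∀ φ : Ω.domain, ‖Γ φ‖ ^ 2 ≤ C * ‖Ω φ + Complex.I • (φ : H₁)‖ ^ 2)
    {v g : H₀}
    (hg : Tendsto (fun R : ℝ => compBounded Γ (cutoff Ω R) ((opS Ω Γ).adjoint v)) atTop (𝓝 g)) :
    Tendsto (fun R => opS Ω Γ (compBounded Ω.toFun (cutoff Ω R) ((opS Ω Γ).adjoint v))) atTop
      (𝓝 (g - Complex.I • opS Ω Γ ((opS Ω Γ).adjoint v))) := by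
  refine (hg.sub ((((opS Ω Γ).continuous.tendsto _).comp
    (tendsto_cutoff hΩ ((opS Ω Γ).adjoint v))).const_smul Complex.I)).congr' ?_
  filter_upwards [eventually_ne_atTop (0 : ℝ)] with R hR
  rw [compBounded_cutoff_eq_opS hΩ hΓ hR, map_add, map_smul, Function.comp_apply,
    add_sub_cancel_right]

/-- Both sides are limits of matrix elements of `S (Ω Φ_R) S†`, which is symmetric. It is the
correction `-i S S†` that makes `G` symmetric. -/
theorem inner_limit_sub (hΩ : IsSelfAdjoint Ω)
    (hΓ : ∃ C : ℝ, ∀ φ : Ω.domain, ‖Γ φ‖ ^ 2 ≤ C * ‖Ω φ + Complex.I • (φ : H₁)‖ ^ 2)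
    {u v g k : H₀}
    (hg : Tendsto (fun R : ℝ => compBounded Γ (cutoff Ω R) ((opS Ω Γ).adjoint v)) atTop (𝓝 g))
    (hk : Tendsto (fun R : ℝ => compBounded Γ (cutoff Ω R) ((opS Ω Γ).adjoint u)) atTop (𝓝 k)) :
    inner ℂ (g - Complex.I • opS Ω Γ ((opS Ω Γ).adjoint v)) u
      = inner ℂ v (k - Complex.I • opS Ω Γ ((opS Ω Γ).adjoint u)) := by
  have h1 := (tendsto_opS_adjoint hΩ hΓ hg).inner (𝕜 := ℂ) (tendsto_const_nhds (x := u))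
  have h2 := (tendsto_const_nhds (x := v)).inner (𝕜 := ℂ) (tendsto_opS_adjoint hΩ hΓ hk)
  refine tendsto_nhds_unique_of_eventuallyEq h1 h2 ?_
  filter_upwards [eventually_ne_atTop (0 : ℝ)] with R hR
  rw [← ContinuousLinearMap.adjoint_inner_right,
    ← ContinuousLinearMap.adjoint_inner_left (opS Ω Γ) _ v, inner_compBounded_toFun_cutoff hΩ hR]

/-- The operator `A - G + i S S†` is self-adjoint. -/
theorem exists_isSelfAdjoint_addOnDomain (hA : IsSelfAdjoint A) (hΩ : IsSelfAdjoint Ω)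
    (hΓ : ∃ C : ℝ, ∀ φ : Ω.domain, ‖Γ φ‖ ^ 2 ≤ C * ‖Ω φ + Complex.I • (φ : H₁)‖ ^ 2)
    (G : A.domain → H₀)
    (hG : ∀ v : A.domain, Tendsto
      (fun R : ℝ => compBounded Γ (cutoff Ω R) ((opS Ω Γ).adjoint (v : H₀))) atTop (𝓝 (G v)))
    (hGA : ∃ δ β : ℝ, δ < 1 ∧ 0 < β ∧
      ∀ v : A.domain, ‖G v‖ ≤ δ * ‖A v + (Complex.I * β) • (v : H₀)‖) :
    ∃ B : A.domain →ₗ[ℂ] H₀, IsSelfAdjoint (addOnDomain A B) ∧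
      ∀ v : A.domain, B v = Complex.I • opS Ω Γ ((opS Ω Γ).adjoint (v : H₀)) - G v := by
  let S := opS Ω Γ
  let G' : A.domain →ₗ[ℂ] H₀ :=
    { toFun := G
      map_add' := fun u v => tendsto_nhds_unique (hG (u + v)) (by
        simpa only [Submodule.coe_add, map_add] using (hG u).add (hG v))
      map_smul' := fun c v => tendsto_nhds_unique (hG (c • v)) (by
        simpa only [Submodule.coe_smul, map_smul, RingHom.id_apply] using (hG v).const_smul c) }
  let B : A.domain →ₗ[ℂ] H₀ := (Complex.I • (S ∘L S.adjoint)).toLinearMap ∘ₗ A.domain.subtype - G'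
  have hB : ∀ v : A.domain, B v = Complex.I • S (S.adjoint (v : H₀)) - G v := fun v => rfl
  obtain ⟨δ, β, hδ, hβ, hδβ⟩ := hGA
  -- Since `δ` may be negative, the relative bound is `max δ 0`. The constant `b` collects `‖S S†‖`
  -- and the term `i β` split off from `‖(A + i β) v‖`.
  refine ⟨B, isSelfAdjoint_addOnDomain hA B (fun u v => ?_) (le_max_right δ 0)
    (max_lt hδ one_pos) (b := ‖S ∘L S.adjoint‖ + max δ 0 * β) (fun v => ?_), hB⟩
  · have h := inner_limit_sub hΩ hΓ (hG u) (hG v)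
    rw [hB, hB, ← neg_sub, ← neg_sub (G v), inner_neg_left, inner_neg_right]
    exact congrArg Neg.neg h
  · rw [hB]
    have h1 := norm_sub_le (Complex.I • S (S.adjoint (v : H₀))) (G v)
    rw [norm_smul, Complex.norm_I, one_mul] at h1
    have h2 : ‖S (S.adjoint (v : H₀))‖ ≤ ‖S ∘L S.adjoint‖ * ‖(v : H₀)‖ :=
      (S ∘L S.adjoint).le_opNorm (v : H₀)
    have h3 := mul_le_mul_of_nonneg_right (le_max_left δ 0)
      (norm_nonneg (A v + (Complex.I * β) • (v : H₀)))
    have h4 := mul_le_mul_of_nonneg_left (norm_add_le (A v) ((Complex.I * (β : ℂ)) • (v : H₀)))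
      (le_max_right δ 0)
    have h5 : ‖(Complex.I * (β : ℂ)) • (v : H₀)‖ = β * ‖(v : H₀)‖ := by
      rw [norm_smul]; simp [abs_of_pos hβ]
    rw [h5] at h4
    have h6 := hδβ v
    linarith

theorem mem_domain_of_inner_eq {T : H →ₗ.[ℂ] H} (hT : IsSelfAdjoint T) {y z : H}
    (h : ∀ x : T.domain, inner ℂ z (x : H) = inner ℂ y (T x)) : y ∈ T.domain :=
  (congrArg LinearPMap.domain (LinearPMap.isSelfAdjoint_def.mp hT)).le
    (LinearPMap.mem_adjoint_domain_of_exists y ⟨z, h⟩)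

theorem dense_blockOperator_domain (hA : IsSelfAdjoint A) (hΩ : IsSelfAdjoint Ω)
    (hdom : ∀ (v : A.domain) (φ : Ω.domain),
      WithLp.toLp 2 ((v : H₀), (φ : H₁) - (opS Ω Γ).adjoint (v : H₀))
        ∈ (blockOperator A Ω Γ).domain) :
    Dense ((blockOperator A Ω Γ).domain : Set (WithLp 2 (H₀ × H₁))) := by
  rw [Submodule.dense_iff_topologicalClosure_eq_top, Submodule.topologicalClosure_eq_top_iff,
    Submodule.eq_bot_iff]
  intro Y hY
  rw [Submodule.mem_orthogonal] at hY
  have h1 : ∀ (v : A.domain) (φ : Ω.domain),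
      inner ℂ (v : H₀) Y.fst + inner ℂ ((φ : H₁) - (opS Ω Γ).adjoint (v : H₀)) Y.snd = 0 :=
    fun v φ => hY _ (hdom v φ)
  -- Vectors `(0, φ)` first kill the second component; only then does the term `S† v` drop out for
  -- the first.
  have h2 : Y.snd = 0 := hΩ.dense_domain.eq_zero_of_inner_right ℂ fun φ hφ => by
    simpa using h1 0 ⟨φ, hφ⟩
  have h3 : Y.fst = 0 := hA.dense_domain.eq_zero_of_inner_right ℂ fun v hv => by
    simpa [h2] using h1 ⟨v, hv⟩ 0
  exact WithLp.ofLp_injective 2 (Prod.ext h3 h2)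

/-- If `⟨Z, V⟩ = ⟨Y, 𝒜 V⟩` for all `V ∈ D(𝒜)`, then `Y ∈ D(𝒜)`. -/
theorem mem_domain_of_inner_block_eq (hΩ : IsSelfAdjoint Ω)
    (hΓ : ∃ C : ℝ, ∀ φ : Ω.domain, ‖Γ φ‖ ^ 2 ≤ C * ‖Ω φ + Complex.I • (φ : H₁)‖ ^ 2)
    {G : A.domain → H₀} {B : A.domain →ₗ[ℂ] H₀} (hB : IsSelfAdjoint (addOnDomain A B))
    (hBG : ∀ v : A.domain, B v = Complex.I • opS Ω Γ ((opS Ω Γ).adjoint (v : H₀)) - G v)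
    {y₀ z₀ : H₀} {y₁ z₁ : H₁}
    (h : ∀ (v : A.domain) (φ : Ω.domain),
      inner ℂ z₀ (v : H₀) + inner ℂ z₁ ((φ : H₁) - (opS Ω Γ).adjoint (v : H₀))
        = inner ℂ y₀ (A v + (Γ φ - G v))
          + inner ℂ y₁ (Ω φ - Complex.I • (opS Ω Γ).adjoint (v : H₀))) :
    y₀ ∈ A.domain ∧ y₁ + (opS Ω Γ).adjoint y₀ ∈ Ω.domain := by
  have hG0 : G 0 = 0 := by
    have := hBG 0
    simpa using this.symm
  constructor
  -- The vector paired with `v` arises from the relation at `φ = 0` by moving `S†` off `v`; its last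
  -- term accounts for the summand `i S S†` of `B`.
  · suffices hz : ∀ v : A.domain, inner ℂ (z₀ - opS Ω Γ z₁ - Complex.I • opS Ω Γ y₁
        - Complex.I • opS Ω Γ ((opS Ω Γ).adjoint y₀)) (v : H₀) = inner ℂ y₀ (A v + B v) from
      mem_domain_of_inner_eq hB hz
    intro v
    have h1 := h v 0
    rw [hBG]
    simp only [map_zero, LinearPMap.map_zero, Submodule.coe_zero, zero_sub, inner_neg_right,
      inner_add_right, inner_smul_right, ContinuousLinearMap.adjoint_inner_right]
      at h1
    simp only [inner_add_right, inner_sub_right, inner_sub_left, inner_smul_left,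
      inner_smul_right, Complex.conj_I]
    rw [← ContinuousLinearMap.adjoint_inner_right (opS Ω Γ) ((opS Ω Γ).adjoint y₀),
      ← ContinuousLinearMap.adjoint_inner_left (opS Ω Γ) _ y₀]
    linear_combination h1
  -- At `v = 0`, writing `Γ φ = S (Ω φ + i φ)` merges `⟨y₀, Γ φ⟩` and `⟨y₁, Ω φ⟩` into `⟨y₁ + S† y₀,
  -- Ω φ⟩` plus `i ⟨S† y₀, φ⟩`; the latter goes into `z`.
  · refine mem_domain_of_inner_eq hΩ (z := z₁ + Complex.I • (opS Ω Γ).adjoint y₀) fun φ => ?_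
    have h1 := h 0 φ
    rw [← opS_spec hΩ hΓ φ, hG0] at h1
    simp only [LinearPMap.map_zero, Submodule.coe_zero, map_zero, smul_zero, sub_zero, zero_add,
      inner_zero_right, ← ContinuousLinearMap.adjoint_inner_left, inner_add_right,
      inner_smul_right] at h1
    simp only [inner_add_left, inner_smul_left, Complex.conj_I]
    linear_combination h1

theorem isSelfAdjoint_blockOperator (hA : IsSelfAdjoint A) (hΩ : IsSelfAdjoint Ω)
    (hΓ : ∃ C : ℝ, ∀ φ : Ω.domain, ‖Γ φ‖ ^ 2 ≤ C * ‖Ω φ + Complex.I • (φ : H₁)‖ ^ 2)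
    (G : A.domain → H₀)
    (hG : ∀ v : A.domain, Tendsto
      (fun R : ℝ => compBounded Γ (cutoff Ω R) ((opS Ω Γ).adjoint (v : H₀))) atTop (𝓝 (G v)))
    (hGA : ∃ δ β : ℝ, δ < 1 ∧ 0 < β ∧
      ∀ v : A.domain, ‖G v‖ ≤ δ * ‖A v + (Complex.I * β) • (v : H₀)‖) :
    IsSelfAdjoint (blockOperator A Ω Γ) := by
  have hdom : ∀ (v : A.domain) (φ : Ω.domain),
      WithLp.toLp 2 ((v : H₀), (φ : H₁) - (opS Ω Γ).adjoint (v : H₀))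
        ∈ (blockOperator A Ω Γ).domain := fun v φ =>
    ⟨v.2, _, tendsto_blockApprox hΩ hΓ v φ (hG v)⟩
  have happly : ∀ (v : A.domain) (φ : Ω.domain), blockOperator A Ω Γ ⟨_, hdom v φ⟩
      = WithLp.toLp 2 (A v + (Γ φ - G v), Ω φ - Complex.I • (opS Ω Γ).adjoint (v : H₀)) :=
    fun v φ => tendsto_nhds_unique (tendsto_blockOperator A Ω Γ ⟨_, hdom v φ⟩)
      (tendsto_blockApprox hΩ hΓ v φ (hG v))
  obtain ⟨B, hB, hBG⟩ := exists_isSelfAdjoint_addOnDomain hA hΩ hΓ G hG hGA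
  refine isSelfAdjoint_of_adjoint_domain_le (dense_blockOperator_domain hA hΩ hdom)
    (inner_blockOperator hA hΩ) fun Y Z hYZ => ?_
  refine (mem_blockOperator_domain_iff hΩ hΓ (fun v => ⟨G v, hG v⟩) Y).mpr
    (mem_domain_of_inner_block_eq hΩ hΓ hB hBG (z₀ := Z.fst) (z₁ := Z.snd) fun v φ => ?_)
  have h := hYZ ⟨_, hdom v φ⟩
  rw [happly] at h
  exact h

end selfAdjoint

end BlockOperator

end

/-! ### The two descriptions of the domain, and self-adjointness -/

open Filter Topology in
theorem mainTheorem8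
    {H₀ H₁ : Type*}
    [NormedAddCommGroup H₀] [InnerProductSpace ℂ H₀] [CompleteSpace H₀]
    [NormedAddCommGroup H₁] [InnerProductSpace ℂ H₁] [CompleteSpace H₁]
    (A : H₀ →ₗ.[ℂ] H₀) (hA : IsSelfAdjoint A)
    (Ω₁ : H₁ →ₗ.[ℂ] H₁) (hΩ₁ : IsSelfAdjoint Ω₁)
    (Γ : Ω₁.domain →ₗ[ℂ] H₀)
    (hΓ : ∃ C : ℝ, ∀ φ : Ω₁.domain, ‖Γ φ‖ ^ 2 ≤ C * ‖Ω₁ φ + Complex.I • (φ : H₁)‖ ^ 2)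
    (G : A.domain → H₀)
    (hG : ∀ v : A.domain, Tendsto
      (fun R : ℝ => BlockOperator.compBounded Γ (BlockOperator.cutoff Ω₁ R)
        ((BlockOperator.opS Ω₁ Γ).adjoint (v : H₀)))
      atTop (𝓝 (G v)))
    (hGA : ∃ δ β : ℝ, δ < 1 ∧ 0 < β ∧
      ∀ v : A.domain, ‖G v‖ ≤ δ * ‖A v + (Complex.I * β) • (v : H₀)‖) :
    (∀ V : WithLp 2 (H₀ × H₁), V ∈ (BlockOperator.blockOperator A Ω₁ Γ).domain ↔
      V.fst ∈ A.domain ∧ ∃ L : H₁, Tendsto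
        (fun R : ℝ =>
          (BlockOperator.compBounded Γ (BlockOperator.cutoff Ω₁ R)).adjoint V.fst
            + BlockOperator.compBounded Ω₁.toFun (BlockOperator.cutoff Ω₁ R) V.snd)
        atTop (𝓝 L)) ∧
    (∀ V : WithLp 2 (H₀ × H₁), V ∈ (BlockOperator.blockOperator A Ω₁ Γ).domain ↔
      ∃ v : A.domain, ∃ φ : Ω₁.domain,
        V = WithLp.toLp 2 ((v : H₀), (φ : H₁) - (BlockOperator.opS Ω₁ Γ).adjoint (v : H₀))) ∧
    IsSelfAdjoint (BlockOperator.blockOperator A Ω₁ Γ) := by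
  have hmem := BlockOperator.mem_blockOperator_domain_iff (A := A) hΩ₁ hΓ fun v => ⟨G v, hG v⟩
  refine ⟨fun V => ?_, fun V => ?_,
    BlockOperator.isSelfAdjoint_blockOperator hA hΩ₁ hΓ G hG hGA⟩
  · rw [hmem, BlockOperator.exists_tendsto_adjoint_add_iff hΩ₁ hΓ]
  · rw [hmem]
    constructor
    · rintro ⟨h, h'⟩
      refine ⟨⟨V.fst, h⟩, ⟨_, h'⟩, ?_⟩
      rw [add_sub_cancel_right]
      rfl
    · rintro ⟨v, φ, rfl⟩
      refine ⟨v.2, ?_⟩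
      change (φ : H₁) - (BlockOperator.opS Ω₁ Γ).adjoint (v : H₀)
        + (BlockOperator.opS Ω₁ Γ).adjoint (v : H₀) ∈ Ω₁.domain
      rw [sub_add_cancel]
      exact φ.2
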